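/- A partition is a finite weakly decreasing sequence of positive integers, identified with its Young diagram. A skew shape $\sigma/\rho$ is the set-theoretic difference of the Young diagrams of two partitions with $\rho\subseteq\sigma$, and two skew shapes are considered equal if one is a translate of the other. A skew shape is connected if any two of its squares can be joined by a sequence of its squares in which consecutive squares share an edge. For a skew shape $\alpha$ let $\mathrm{col}(\alpha)$, $\mathrm{row}(\alpha)$ and $\mathrm{area}(\alpha)$ be its numbers of nonempty columns, nonempty rows and squares, and for an integer $k$ call the set of squares of $\alpha$ in row $i$ and column $j$ with $i-j=k$ a diagonal of $\alpha$. Let $\mathrm{CS}^{\le k}$ be the set of nonempty connected skew shapes in which every diagonal has at most $k$ squares. **Proposition.** For every integer $m\ge 0$, the following identity of formal power series holds in $\mathbb{Z}[[x,y,q]]$, the sum on the left being coefficientwise convergent: \[ \sum_{\alpha\in \mathrm{CS}^{\le m+1}} x^{\mathrm{col}(\alpha)}y^{\mathrm{row}(\alpha)}q^{\mathrm{area}(\alpha)} =\cfrac{qxy}{1-q(x+y)-\cfrac{q^3xy}{1-q^2(x+y)-\cdots-\cfrac{q^{2m+1}xy}{1-q^{m+1}(x+y)}}}, \] where the finite continued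 fraction has the $m+1$ partial numerators $q^{2i+1}xy$ and partial denominators $1-q^{i+1}(x+y)$, $0\le i\le m$ (for $m=0$ it is $qxy/(1-q(x+y))$). -/

import Mathlib

open scoped MvPowerSeries.WithPiTopology

/-- A pair of partitions `inner ⊆ outer`, given by their Young diagrams. -/
structure SkewDiagram where
  outer : YoungDiagram
  inner : YoungDiagram
  le : inner ≤ outer

/-! Cells are pairs (row, column) of integers; `Cells` collects the notions for finite sets of
cells that are used below. -/
namespace Cells

/-- The set `S` of cells translated by `v`. -/
def translate (v : ℤ × ℤ) (S : Finset (ℤ × ℤ)) : Finset (ℤ × ℤ) :=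
  S.map (Equiv.addRight v).toEmbedding

/-- Number of nonempty rows. -/
def row (S : Finset (ℤ × ℤ)) : ℕ := (S.image Prod.fst).card

/-- Number of nonempty columns. -/
def col (S : Finset (ℤ × ℤ)) : ℕ := (S.image Prod.snd).card

/-- The two cells share an edge. -/
def Adj (u v : ℤ × ℤ) : Prop := |u.1 - v.1| + |u.2 - v.2| = 1

/-- Any two cells of `S` are joined by a sequence of cells of `S` in which consecutive cells
share an edge. -/
def Connected (S : Finset (ℤ × ℤ)) : Prop :=
  ∀ u ∈ S, ∀ v ∈ S, Relation.ReflTransGen (fun a b => a ∈ S ∧ b ∈ S ∧ Adj a b) u v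

/-- The cells of `S` in row `i` and column `j` with `i - j = k`. -/
def diagonal (S : Finset (ℤ × ℤ)) (k : ℤ) : Finset (ℤ × ℤ) := S.filter fun c => c.1 - c.2 = k

/-- Every diagonal of `S` has at most `m` cells. -/
def DiagonalsLE (m : ℕ) (S : Finset (ℤ × ℤ)) : Prop := ∀ k : ℤ, (diagonal S k).card ≤ m

theorem mem_translate {v : ℤ × ℤ} {S : Finset (ℤ × ℤ)} {c : ℤ × ℤ} :
    c ∈ translate v S ↔ c - v ∈ S := by
  simp only [translate, Finset.mem_map, Equiv.coe_toEmbedding, Equiv.coe_addRight]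
  constructor
  · rintro ⟨a, ha, rfl⟩
    simpa using ha
  · intro h
    exact ⟨c - v, h, by simp⟩

theorem translate_zero (S : Finset (ℤ × ℤ)) : translate 0 S = S := by
  ext c
  simp [mem_translate]

theorem translate_translate (v w : ℤ × ℤ) (S : Finset (ℤ × ℤ)) :
    translate w (translate v S) = translate (v + w) S := by
  ext c
  simp [mem_translate, sub_sub, add_comm]

theorem card_translate (v : ℤ × ℤ) (S : Finset (ℤ × ℤ)) : (translate v S).card = S.card :=
  Finset.card_map _

theorem row_translate (v : ℤ × ℤ) (S : Finset (ℤ × ℤ)) : row (translate v S) = row S := by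
  have h : (translate v S).image Prod.fst = (S.image Prod.fst).map
      (Equiv.addRight v.1).toEmbedding := by
    simp only [translate, Finset.map_eq_image, Finset.image_image]
    rfl
  rw [row, h, Finset.card_map, row]

theorem col_translate (v : ℤ × ℤ) (S : Finset (ℤ × ℤ)) : col (translate v S) = col S := by
  have h : (translate v S).image Prod.snd = (S.image Prod.snd).map
      (Equiv.addRight v.2).toEmbedding := by
    simp only [translate, Finset.map_eq_image, Finset.image_image]
    rfl
  rw [col, h, Finset.card_map, col]

theorem Connected.translate {S : Finset (ℤ × ℤ)} (h : Connected S) (v : ℤ × ℤ) :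
    Connected (translate v S) := by
  intro a ha b hb
  have key := h (a - v) (mem_translate.1 ha) (b - v) (mem_translate.1 hb)
  have hl : ∀ c d, Relation.ReflTransGen (fun a b => a ∈ S ∧ b ∈ S ∧ Adj a b) c d →
      Relation.ReflTransGen (fun a b => a ∈ Cells.translate v S ∧
        b ∈ Cells.translate v S ∧ Adj a b) (c + v) (d + v) := by
    intro c d hcd
    induction hcd with
    | refl => exact .refl
    | tail _ hbc ih => exact ih.tail (by simpa [mem_translate, Adj] using hbc)
  simpa using hl _ _ key

theorem DiagonalsLE.translate {m : ℕ} {S : Finset (ℤ × ℤ)} (h : DiagonalsLE m S) (v : ℤ × ℤ) :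
    DiagonalsLE m (translate v S) := by
  intro k
  have : diagonal (Cells.translate v S) k =
      Cells.translate v (diagonal S (k - (v.1 - v.2))) := by
    ext c
    simp only [diagonal, Finset.mem_filter, mem_translate, Prod.fst_sub, Prod.snd_sub]
    refine and_congr_right fun _ => ?_
    omega
  rw [this, card_translate]
  exact h _

end Cells

namespace SkewDiagram

/-- The set-theoretic difference of the two Young diagrams, as cells (row, column). -/
def cells (s : SkewDiagram) : Finset (ℤ × ℤ) :=
  (s.outer.cells \ s.inner.cells).image fun c => ((c.1 : ℤ), (c.2 : ℤ))

/-- Two skew diagrams are identified when one set of cells is a translate of the other. -/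
instance setoid : Setoid SkewDiagram where
  r s t := ∃ v : ℤ × ℤ, t.cells = Cells.translate v s.cells
  iseqv :=
    { refl := fun s => ⟨0, (Cells.translate_zero _).symm⟩
      symm := by
        rintro s t ⟨v, h⟩
        exact ⟨-v, by rw [h, Cells.translate_translate, add_neg_cancel, Cells.translate_zero]⟩
      trans := by
        rintro s t u ⟨v, h⟩ ⟨w, h'⟩
        exact ⟨v + w, by rw [h', h, Cells.translate_translate]⟩ }

theorem iff_of_equiv {P : Finset (ℤ × ℤ) → Prop}
    (hP : ∀ S v, P S → P (Cells.translate v S)) {s t : SkewDiagram} (h : s ≈ t) :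
    P s.cells ↔ P t.cells := by
  constructor
  · intro hs
    obtain ⟨v, hv⟩ := h
    exact hv ▸ hP _ v hs
  · intro ht
    obtain ⟨v, hv⟩ := Setoid.symm h
    exact hv ▸ hP _ v ht

end SkewDiagram

/-- Skew shapes: skew diagrams up to translation. -/
def SkewShape : Type := Quotient SkewDiagram.setoid

namespace SkewShape

/-- Number of nonempty columns. -/
def col (α : SkewShape) : ℕ :=
  Quotient.lift (fun s : SkewDiagram => Cells.col s.cells)
    (by rintro s t ⟨v, h⟩; simp only [h, Cells.col_translate]) α

/-- Number of nonempty rows. -/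
def row (α : SkewShape) : ℕ :=
  Quotient.lift (fun s : SkewDiagram => Cells.row s.cells)
    (by rintro s t ⟨v, h⟩; simp only [h, Cells.row_translate]) α

/-- Number of squares. -/
def area (α : SkewShape) : ℕ :=
  Quotient.lift (fun s : SkewDiagram => s.cells.card)
    (by rintro s t ⟨v, h⟩; simp only [h, Cells.card_translate]) α

def Connected (α : SkewShape) : Prop :=
  Quotient.lift (fun s : SkewDiagram => Cells.Connected s.cells)
    (fun _ _ h => propext (SkewDiagram.iff_of_equiv (fun _ v hS => hS.translate v) h)) α

/-- Every diagonal has at most `m` squares. -/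
def DiagonalsLE (m : ℕ) (α : SkewShape) : Prop :=
  Quotient.lift (fun s : SkewDiagram => Cells.DiagonalsLE m s.cells)
    (fun _ _ h => propext (SkewDiagram.iff_of_equiv (fun _ v hS => hS.translate v) h)) α

/-- The set of all nonempty connected skew shapes. -/
def CS : Set SkewShape := {α | 0 < α.area ∧ α.Connected}

/-- The set of nonempty connected skew shapes in which every diagonal has at most `m` squares. -/
def CSle (m : ℕ) : Set SkewShape := {α | α ∈ CS ∧ α.DiagonalsLE m}

end SkewShape

namespace SkewGF

/-- The ring `ℤ⟦x, y, q⟧`, with the topology of coefficientwise convergence (`ℤ` discrete). -/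
abbrev PS : Type := MvPowerSeries (Fin 3) ℤ

noncomputable def x : PS := MvPowerSeries.X 0
noncomputable def y : PS := MvPowerSeries.X 1
noncomputable def q : PS := MvPowerSeries.X 2

/-- The finite continued fraction with levels `i, i + 1, …, i + n`, where level `k` has
numerator `q ^ (2k+1) x y` and partial denominator `1 - q ^ (k+1) (x + y)`. `Ring.inverse` is the
inverse in the ring `ℤ⟦x, y, q⟧`; every denominator is a unit, see `isUnit_den`. -/
noncomputable def contFrac : ℕ → ℕ → PS
  | 0, i => q ^ (2 * i + 1) * x * y * Ring.inverse (1 - q ^ (i + 1) * (x + y))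
  | n + 1, i => q ^ (2 * i + 1) * x * y *
      Ring.inverse (1 - q ^ (i + 1) * (x + y) - contFrac n (i + 1))

theorem constantCoeff_contFrac (n i : ℕ) : MvPowerSeries.constantCoeff (contFrac n i) = 0 := by
  cases n <;> simp [contFrac, x]

theorem isUnit_den (n i : ℕ) :
    IsUnit (1 - q ^ (i + 1) * (x + y)) ∧
      IsUnit (1 - q ^ (i + 1) * (x + y) - contFrac n (i + 1)) := by
  simp [MvPowerSeries.isUnit_iff_constantCoeff, constantCoeff_contFrac, x, y]

end SkewGF

/-! The cells of a skew diagram form an order-convex subset of `ℤ × ℤ`, and every finite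
order-convex set is a translate of such a set of cells. In a convex set each nonempty diagonal is an
interval of rows `[s, t]`. On passing to the next nonempty diagonal, convexity forces each of `s`
and `t` to stay or to grow by one. Connectedness leaves no diagonal empty between the two extreme
ones, and an extreme diagonal has a single cell. A connected shape is therefore the same thing as a
Motzkin path with two kinds of level step, whose height is `t - s`. It starts and ends at height 0,
and the bound of `m + 1` on diagonals becomes height at most `m`.

Under this bijection (`shapeOf_bijective`) the area is the sum of height plus one over the vertices.
A step gives a new row when `t` grows and a new column when `s` stays, so level steps weigh `x` or
`y`, up steps `x * y` and down steps 1. Flajolet's argument then applies: removing the first step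
gives a three-term recursion in the starting height (`pathGF_rec`), and its successive ratios unfold
into the continued fraction (`mul_pathGF_succ`, `mul_pathGF_zero`). -/

namespace SkewGF

/-! ### Paths coded by lists of pairs of Booleans -/

/-- The number of the first `n` entries of `l` that satisfy `p`. -/
def cnt (p : Bool × Bool → Bool) (l : List (Bool × Bool)) (n : ℕ) : ℤ := ((l.take n).countP p : ℕ)

theorem cnt_zero (p : Bool × Bool → Bool) (l : List (Bool × Bool)) : cnt p l 0 = 0 := by
  simp [cnt]

theorem cnt_nil (p : Bool × Bool → Bool) (n : ℕ) : cnt p [] n = 0 := by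
  simp [cnt]

theorem cnt_cons_succ (p : Bool × Bool → Bool) (e : Bool × Bool) (l : List (Bool × Bool)) (n : ℕ) :
    cnt p (e :: l) (n + 1) = (if p e then 1 else 0) + cnt p l n := by
  simp only [cnt, List.take_succ_cons, List.countP_cons]
  push_cast
  ring

theorem cnt_length (p : Bool × Bool → Bool) (l : List (Bool × Bool)) :
    cnt p l l.length = l.countP p := by
  simp [cnt]

theorem cnt_succ (p : Bool × Bool → Bool) (l : List (Bool × Bool)) (n : ℕ) :
    cnt p l n ≤ cnt p l (n + 1) ∧ cnt p l (n + 1) ≤ cnt p l n + 1 := by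
  induction l generalizing n with
  | nil => simp [cnt_nil]
  | cons e l ih =>
    cases n with
    | zero =>
      rw [cnt_cons_succ, cnt_zero, cnt_zero]
      split_ifs <;> simp
    | succ n =>
      have := ih n
      rw [cnt_cons_succ, cnt_cons_succ]
      omega

/-- The difference of the numbers of second and first entries among the first `n` pairs. -/
def height (l : List (Bool × Bool)) (n : ℕ) : ℤ := cnt Prod.snd l n - cnt Prod.fst l n

/-- Change of height under one step. -/
def rise (e : Bool × Bool) : ℤ := (if e.2 then 1 else 0) - (if e.1 then 1 else 0)

theorem height_zero (l : List (Bool × Bool)) : height l 0 = 0 := by simp [height, cnt_zero]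

theorem height_cons_succ (e : Bool × Bool) (l : List (Bool × Bool)) (n : ℕ) :
    height (e :: l) (n + 1) = rise e + height l n := by
  simp only [height, cnt_cons_succ, rise]
  ring

/-- The path starting at height `h` with steps `l` stays between `0` and `m` and ends at `0`. -/
def Valid (m : ℕ) (h : ℤ) (l : List (Bool × Bool)) : Prop :=
  (∀ n ≤ l.length, 0 ≤ h + height l n ∧ h + height l n ≤ m) ∧ h + height l l.length = 0

theorem valid_nil (m : ℕ) (h : ℤ) : Valid m h [] ↔ h = 0 := by
  simp only [Valid, List.length_nil, Nat.le_zero, forall_eq, height_zero]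
  omega

theorem valid_cons (m : ℕ) (h : ℤ) (e : Bool × Bool) (l : List (Bool × Bool)) :
    Valid m h (e :: l) ↔ (0 ≤ h ∧ h ≤ m) ∧ Valid m (h + rise e) l := by
  simp only [Valid, List.length_cons, height_cons_succ, add_assoc]
  constructor
  · rintro ⟨h1, h2⟩
    refine ⟨by simpa [height_zero] using h1 0 (by omega), fun n hn => ?_, h2⟩
    simpa [height_cons_succ] using h1 (n + 1) (by omega)
  · rintro ⟨h0, h1, h2⟩
    refine ⟨fun n hn => ?_, h2⟩
    cases n with
    | zero => simpa [height_zero] using h0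
    | succ n => simpa [height_cons_succ] using h1 n (by omega)

theorem Valid.nonneg_and_le {m : ℕ} {h : ℤ} {l : List (Bool × Bool)} (hv : Valid m h l) :
    0 ≤ h ∧ h ≤ m := by
  simpa [height_zero] using hv.1 0 (by omega)

/-- Sum over the vertices of a path of the height plus one. -/
def pathArea (h : ℤ) (l : List (Bool × Bool)) : ℕ :=
  ∑ n ∈ Finset.range (l.length + 1), (h + height l n + 1).toNat

theorem pathArea_nil (h : ℤ) : pathArea h [] = (h + 1).toNat := by
  simp [pathArea, height_zero]

theorem pathArea_cons (h : ℤ) (e : Bool × Bool) (l : List (Bool × Bool)) :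
    pathArea h (e :: l) = (h + 1).toNat + pathArea (h + rise e) l := by
  rw [pathArea, List.length_cons, Finset.sum_range_succ', height_zero, add_zero, add_comm]
  simp only [height_cons_succ, pathArea, add_assoc]

theorem Valid.length_le_pathArea {m : ℕ} {h : ℤ} {l : List (Bool × Bool)} (hv : Valid m h l) :
    l.length ≤ pathArea h l := by
  have : ∑ n ∈ Finset.range (l.length + 1), 1 ≤ pathArea h l := by
    refine Finset.sum_le_sum fun n hn => ?_
    have := (hv.1 n (by simpa [Nat.lt_succ_iff] using hn)).1
    omega
  simp at this
  omega

/-! ### Weights and generating functions of paths -/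

open Classical in
/-- The weight of a path, zero if the path is not valid. -/
noncomputable def weight (m : ℕ) (h : ℤ) (l : List (Bool × Bool)) : PS :=
  if Valid m h l then
    x ^ l.countP (fun e => !e.1) * y ^ l.countP Prod.snd * q ^ pathArea h l else 0

/-- The weight of a step. -/
noncomputable def stepWeight (e : Bool × Bool) : PS :=
  (if e.1 then 1 else x) * (if e.2 then y else 1)

theorem weight_nil (m : ℕ) (h : ℤ) : weight m h [] = if h = 0 then q else 0 := by
  by_cases h0 : h = 0 <;> simp [weight, valid_nil, h0, pathArea_nil]

theorem weight_cons {m : ℕ} {h : ℤ} (h0 : 0 ≤ h) (hm : h ≤ m) (e : Bool × Bool)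
    (l : List (Bool × Bool)) :
    weight m h (e :: l) = q ^ (h + 1).toNat * stepWeight e * weight m (h + rise e) l := by
  by_cases hv : Valid m (h + rise e) l
  · have h1 : Valid m h (e :: l) := (valid_cons _ _ _ _).2 ⟨⟨h0, hm⟩, hv⟩
    rw [weight, if_pos h1, weight, if_pos hv, pathArea_cons, pow_add, List.countP_cons,
      List.countP_cons, stepWeight]
    rcases e with ⟨a, b⟩
    cases a <;> cases b <;> simp <;> ring
  · have h1 : ¬ Valid m h (e :: l) := fun h' => hv ((valid_cons _ _ _ _).1 h').2
    rw [weight, if_neg h1, weight, if_neg hv, mul_zero]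

theorem coeff_weight_eq_zero (m : ℕ) (h : ℤ) (l : List (Bool × Bool)) (d : Fin 3 →₀ ℕ)
    (hd : d 2 < l.length) : MvPowerSeries.coeff d (weight m h l) = 0 := by
  rw [weight]
  split_ifs with hv
  · have := hv.length_le_pathArea
    rw [q, MvPowerSeries.X_pow_eq, MvPowerSeries.coeff_mul_monomial, if_neg]
    intro hle
    have := hle 2
    simp at this
    omega
  · simp

/-- Area bounds length, so only the finitely many paths of length at most `d 2` contribute to the
coefficient at `d`. -/
theorem summable_weight (m : ℕ) (h : ℤ) : Summable (weight m h) := by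
  refine Pi.summable.2 fun d => ?_
  refine summable_of_hasFiniteSupport (Set.Finite.subset (List.finite_length_le (Bool × Bool) (d 2)) ?_)
  intro l hl
  by_contra hlen
  exact hl (coeff_weight_eq_zero m h l d (by simpa using hlen))

/-- The generating function of valid paths from height `h`. -/
noncomputable def pathGF (m : ℕ) (h : ℤ) : PS := ∑' l, weight m h l

theorem hasSum_weight (m : ℕ) (h : ℤ) : HasSum (weight m h) (pathGF m h) :=
  (summable_weight m h).hasSum

theorem pathGF_eq_zero (m : ℕ) (h : ℤ) (hh : ¬ (0 ≤ h ∧ h ≤ m)) : pathGF m h = 0 := by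
  have : weight m h = 0 := by
    funext l
    exact if_neg fun hv => hh hv.nonneg_and_le
  rw [pathGF, this]
  exact tsum_zero

/-- Splits a sum over words by first letter; the alphabet is finite, so no uniformity is needed. -/
theorem hasSum_list {α M : Type*} [Fintype α] [AddCommMonoid M] [TopologicalSpace M]
    [ContinuousAdd M] {f : List α → M} {a : α → M}
    (hf : ∀ e, HasSum (fun l => f (e :: l)) (a e)) : HasSum f (f [] + ∑ e, a e) := by
  classical
  have h1 : HasSum (fun l : List α => if l = [] then f l else 0) (f []) := by
    simpa using hasSum_single ([] : List α)
      (f := fun l : List α => if l = [] then f l else 0) (fun l hl => if_neg hl)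
  have h2 : ∀ e ∈ (Finset.univ : Finset α),
      HasSum (Function.extend (List.cons e) (fun l => f (e :: l)) 0) (a e) := fun e _ =>
    (hasSum_extend_zero (List.cons_injective)).2 (hf e)
  convert h1.add (hasSum_sum h2) using 1
  funext l
  cases l with
  | nil =>
    rw [if_pos rfl, Finset.sum_eq_zero, add_zero]
    intro e _
    rw [Function.extend_apply' _ _ _ (by simp)]
    rfl
  | cons b l =>
    rw [if_neg (by simp), zero_add, Finset.sum_eq_single b]
    · exact (List.cons_injective.extend_apply (fun l => f (b :: l)) 0 l).symm
    · intro e _ he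
      rw [Function.extend_apply' _ _ _ (by rintro ⟨l', hl'⟩; exact he (List.cons.inj hl').1)]
      rfl
    · simp

/-! ### The recursion and the continued fraction -/

theorem pathGF_rec {m : ℕ} {h : ℤ} (h0 : 0 ≤ h) (hm : h ≤ m) :
    pathGF m h = (if h = 0 then q else 0) + q ^ (h + 1).toNat *
      ((x + y) * pathGF m h + x * y * pathGF m (h + 1) + pathGF m (h - 1)) := by
  have := hasSum_list (f := weight m h)
    (a := fun e => q ^ (h + 1).toNat * stepWeight e * pathGF m (h + rise e)) (fun e => by
      simp only [weight_cons h0 hm]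
      exact (hasSum_weight m (h + rise e)).mul_left _)
  refine ((hasSum_weight m h).unique this).trans ?_
  rw [weight_nil]
  congr 1
  simp only [Fintype.sum_prod_type, Fintype.sum_bool, stepWeight, rise]
  simp [← sub_eq_add_neg]
  ring

theorem contFrac_mul_den (n i : ℕ) : contFrac (n + 1) i *
    (1 - q ^ (i + 1) * (x + y) - contFrac n (i + 1)) = q ^ (2 * i + 1) * x * y := by
  rw [contFrac, mul_assoc, Ring.inverse_mul_cancel _ (isUnit_den n i).2, mul_one]

theorem contFrac_zero_mul_den (i : ℕ) : contFrac 0 i *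
    (1 - q ^ (i + 1) * (x + y)) = q ^ (2 * i + 1) * x * y := by
  rw [contFrac, mul_assoc, Ring.inverse_mul_cancel _ (isUnit_den 0 i).1, mul_one]

/-- Here `n` is the distance from height `i + 1` to the ceiling. At the ceiling the term one level
higher vanishes; below it, the induction hypothesis turns that term into a multiple of the current
one. Both sides are compared after multiplication by the unit denominator. -/
theorem mul_pathGF_succ (n i : ℕ) :
    q ^ (i + 1) * x * y * pathGF (n + (i + 1)) (i + 1) =
      contFrac n (i + 1) * pathGF (n + (i + 1)) i := by
  induction n generalizing i with
  | zero =>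
    refine (isUnit_den 0 (i + 1)).1.mul_right_cancel ?_
    have := pathGF_rec (m := 0 + (i + 1)) (h := (i : ℤ) + 1) (by omega) (by push_cast; omega)
    rw [if_neg (by omega), pathGF_eq_zero (0 + (i + 1)) ((i : ℤ) + 1 + 1) (by push_cast; omega),
      show ((i : ℤ) + 1 + 1).toNat = i + 2 by omega, add_sub_cancel_right] at this
    have h2 := contFrac_zero_mul_den (i + 1)
    linear_combination (q ^ (i + 1) * x * y) * this - pathGF (0 + (i + 1)) i * h2
  | succ n ih =>
    refine (isUnit_den n (i + 1)).2.mul_right_cancel ?_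
    have := pathGF_rec (m := n + 1 + (i + 1)) (h := (i : ℤ) + 1) (by omega) (by push_cast; omega)
    rw [if_neg (by omega),
      show ((i : ℤ) + 1 + 1).toNat = i + 2 by omega, add_sub_cancel_right] at this
    have h2 := contFrac_mul_den n (i + 1)
    have h3 := ih (i + 1)
    rw [show n + (i + 1 + 1) = n + 1 + (i + 1) by omega] at h3
    push_cast at h3
    linear_combination (q ^ (i + 1) * x * y) * this - pathGF (n + 1 + (i + 1)) i * h2 +
      (q ^ (i + 1) * x * y) * h3

theorem mul_pathGF_zero (m : ℕ) : x * y * pathGF m 0 = contFrac m 0 := by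
  have h1 := pathGF_rec (m := m) (h := 0) le_rfl (by omega)
  rw [if_pos rfl, pathGF_eq_zero m (0 - 1) (by omega), show ((0 : ℤ) + 1).toNat = 1 by rfl] at h1
  cases m with
  | zero =>
    refine (isUnit_den 0 0).1.mul_right_cancel ?_
    rw [pathGF_eq_zero 0 (0 + 1) (by simp)] at h1
    linear_combination x * y * h1 - contFrac_zero_mul_den 0
  | succ n =>
    refine (isUnit_den n 0).2.mul_right_cancel ?_
    have h3 := mul_pathGF_succ n 0
    simp only [zero_add, Nat.cast_zero] at h1 h3 ⊢
    linear_combination x * y * h1 - contFrac_mul_den n 0 + x * y * h3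

end SkewGF

/-! ### Connectedness in sets of cells -/

namespace Cells

/-- The relation of being adjacent cells of `S`. -/
abbrev AdjIn (S : Finset (ℤ × ℤ)) (a b : ℤ × ℤ) : Prop := a ∈ S ∧ b ∈ S ∧ Adj a b

theorem reachable_symm {S : Finset (ℤ × ℤ)} {u v : ℤ × ℤ}
    (h : Relation.ReflTransGen (AdjIn S) u v) : Relation.ReflTransGen (AdjIn S) v u := by
  induction h with
  | refl => exact .refl
  | tail _ hbc ih =>
    refine .head ⟨hbc.2.1, hbc.1, ?_⟩ ih
    rw [Adj, abs_sub_comm, abs_sub_comm (Prod.snd _)]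
    exact hbc.2.2

/-- A monotone lattice path from `u` to `v` stays in the order interval, hence in `S`. -/
theorem reachable_of_le {S : Finset (ℤ × ℤ)} (hS : (S : Set (ℤ × ℤ)).OrdConnected)
    {u v : ℤ × ℤ} (hu : u ∈ S) (hv : v ∈ S) (huv : u ≤ v) :
    Relation.ReflTransGen (AdjIn S) u v := by
  obtain ⟨n, hn⟩ : ∃ n : ℕ, (v.1 - u.1) + (v.2 - u.2) = n :=
    Int.eq_ofNat_of_zero_le (by have := huv.1; have := huv.2; omega)
  induction n generalizing u with
  | zero =>
    have h1 := huv.1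
    have h2 := huv.2
    have : u = v := Prod.ext (by omega) (by omega)
    rw [this]
  | succ n ih =>
    have h1 := huv.1
    have h2 := huv.2
    by_cases h : u.1 < v.1
    · have hle : ((u.1 + 1, u.2) : ℤ × ℤ) ≤ v := ⟨by simp; omega, h2⟩
      have hw : ((u.1 + 1, u.2) : ℤ × ℤ) ∈ S := hS.out hu hv ⟨⟨by simp, le_rfl⟩, hle⟩
      exact .head ⟨hu, hw, by simp [Adj]⟩ (ih hw hle (by push_cast at hn ⊢; omega))
    · have hle : ((u.1, u.2 + 1) : ℤ × ℤ) ≤ v := ⟨h1, by simp; push_cast at hn; omega⟩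
      have hw : ((u.1, u.2 + 1) : ℤ × ℤ) ∈ S := hS.out hu hv ⟨⟨le_rfl, by simp⟩, hle⟩
      exact .head ⟨hu, hw, by simp [Adj]⟩ (ih hw hle (by push_cast at hn ⊢; omega))

/-- A discrete intermediate value argument: an edge changes `i - j` by exactly one. -/
theorem Connected.exists_mem_diagonal {S : Finset (ℤ × ℤ)} (hS : Connected S) {u v : ℤ × ℤ}
    (hu : u ∈ S) (hv : v ∈ S) {k : ℤ} (h1 : u.1 - u.2 ≤ k) (h2 : k ≤ v.1 - v.2) :
    ∃ w ∈ S, w.1 - w.2 = k := by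
  have h := hS u hu v hv
  clear hv
  induction h with
  | refl => exact ⟨u, hu, by omega⟩
  | @tail b c _ hbc ih =>
    by_cases hk : k ≤ b.1 - b.2
    · exact ih hk
    · refine ⟨c, hbc.2.1, ?_⟩
      have h3 : |b.1 - c.1| + |b.2 - c.2| = 1 := hbc.2.2
      have h4 := neg_abs_le (b.1 - c.1)
      have h5 := le_abs_self (b.2 - c.2)
      omega

end Cells

/-! ### Skew diagrams as order-convex sets -/

namespace SkewDiagram

theorem mem_cells {s : SkewDiagram} {c : ℤ × ℤ} :
    c ∈ s.cells ↔ ∃ p : ℕ × ℕ, (p ∈ s.outer.cells ∧ p ∉ s.inner.cells) ∧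
      ((p.1 : ℤ), (p.2 : ℤ)) = c := by
  simp only [cells, Finset.mem_image, Finset.mem_sdiff]

theorem ordConnected_cells (s : SkewDiagram) : (s.cells : Set (ℤ × ℤ)).OrdConnected := by
  refine ⟨fun a ha b hb c hc => ?_⟩
  obtain ⟨p, ⟨-, hp⟩, rfl⟩ := mem_cells.1 (Finset.mem_coe.1 ha)
  obtain ⟨r, ⟨hr, -⟩, rfl⟩ := mem_cells.1 (Finset.mem_coe.1 hb)
  obtain ⟨⟨h1, h2⟩, ⟨h3, h4⟩⟩ := hc
  simp only at h1 h2 h3 h4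
  refine Finset.mem_coe.2 (mem_cells.2 ⟨(c.1.toNat, c.2.toNat), ⟨?_, fun h => hp ?_⟩, ?_⟩)
  · exact s.outer.isLowerSet (show (c.1.toNat, c.2.toNat) ≤ r from
      ⟨by simp; omega, by simp; omega⟩) hr
  · exact s.inner.isLowerSet (show p ≤ (c.1.toNat, c.2.toNat) from
      ⟨by simp; omega, by simp; omega⟩) h
  · exact Prod.ext (by simp; omega) (by simp; omega)

/-- Every finite order-convex set of cells in the quadrant is a difference of Young diagrams. -/
theorem exists_sdiff_eq (T : Finset (ℕ × ℕ)) (hT : (T : Set (ℕ × ℕ)).OrdConnected) :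
    ∃ s : SkewDiagram, ∀ p, (p ∈ s.outer.cells ∧ p ∉ s.inner.cells) ↔ p ∈ T := by
  classical
  -- The outer diagram is the lower closure of `T`; the inner one keeps its points that lie above no
  -- point of `T`.
  let A : Finset (ℕ × ℕ) := T.biUnion Finset.Iic
  have hA : ∀ p, p ∈ A ↔ ∃ t ∈ T, p ≤ t := by simp [A]
  have hB : ∀ p, p ∈ A.filter (fun p => ∀ t ∈ T, ¬ t ≤ p) ↔
      (∃ t ∈ T, p ≤ t) ∧ ∀ t ∈ T, ¬ t ≤ p := by simp [hA]
  refine ⟨⟨⟨A, ?_⟩, ⟨A.filter fun p => ∀ t ∈ T, ¬ t ≤ p, ?_⟩, Finset.filter_subset _ _⟩, ?_⟩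
  · intro a b hba ha
    obtain ⟨t, ht, hat⟩ := (hA a).1 ha
    exact (hA b).2 ⟨t, ht, hba.trans hat⟩
  · intro a b hba ha
    obtain ⟨⟨t, ht, hat⟩, h⟩ := (hB a).1 ha
    exact (hB b).2 ⟨⟨t, ht, hba.trans hat⟩, fun t ht htb => h t ht (htb.trans hba)⟩
  · intro p
    change p ∈ A ∧ p ∉ A.filter (fun p => ∀ t ∈ T, ¬ t ≤ p) ↔ _
    rw [hA, hB]
    constructor
    · rintro ⟨⟨t, ht, hpt⟩, h⟩
      have : ∃ r ∈ T, r ≤ p := by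
        by_contra! h'
        exact h ⟨⟨t, ht, hpt⟩, h'⟩
      obtain ⟨r, hr, hrp⟩ := this
      exact hT.out hr ht ⟨hrp, hpt⟩
    · exact fun hp => ⟨⟨p, hp, le_rfl⟩, fun h => h.2 p hp le_rfl⟩

theorem exists_cells_eq_translate (S : Finset (ℤ × ℤ)) (hS : (S : Set (ℤ × ℤ)).OrdConnected) :
    ∃ (s : SkewDiagram) (v : ℤ × ℤ), s.cells = Cells.translate v S := by
  classical
  obtain ⟨b, hb⟩ := S.finite_toSet.bddBelow
  have hb1 : ∀ c ∈ S, b.1 ≤ c.1 ∧ b.2 ≤ c.2 := fun c hc => hb (Finset.mem_coe.2 hc)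
  let g : ℤ × ℤ → ℕ × ℕ := fun c => ((c.1 - b.1).toNat, (c.2 - b.2).toNat)
  have hg : ∀ p : ℕ × ℕ, p ∈ S.image g ↔ ((p.1 + b.1, p.2 + b.2) : ℤ × ℤ) ∈ S := by
    intro p
    rw [Finset.mem_image]
    constructor
    · rintro ⟨c, hc, rfl⟩
      have := hb1 c hc
      convert hc using 1
      exact Prod.ext (by simp only [g]; omega) (by simp only [g]; omega)
    · exact fun h => ⟨_, h, Prod.ext (by simp [g]) (by simp [g])⟩
  obtain ⟨s, hs⟩ := exists_sdiff_eq (S.image g) ⟨fun a ha c hc p hp => by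
    rw [Finset.mem_coe, hg] at *
    obtain ⟨⟨h1, h2⟩, ⟨h3, h4⟩⟩ := hp
    exact hS.out ha hc ⟨⟨by simpa using h1, by simpa using h2⟩,
      ⟨by simpa using h3, by simpa using h4⟩⟩⟩
  refine ⟨s, -b, ?_⟩
  ext c
  rw [mem_cells, Cells.mem_translate, sub_neg_eq_add]
  constructor
  · rintro ⟨p, hp, rfl⟩
    exact (hg p).1 ((hs p).1 hp)
  · intro hc
    have h := hb1 _ hc
    simp only [Prod.fst_add, Prod.snd_add] at h
    refine ⟨(c.1.toNat, c.2.toNat), (hs _).2 ((hg _).2 ?_), ?_⟩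
    · convert hc using 1
      exact Prod.ext (by simp; omega) (by simp; omega)
    · exact Prod.ext (by simp; omega) (by simp; omega)

end SkewDiagram

/-! ### From paths to sets of cells -/

namespace SkewGF

open Cells

theorem cnt_mono (p : Bool × Bool → Bool) (l : List (Bool × Bool)) {a b : ℕ} (hab : a ≤ b) :
    cnt p l a ≤ cnt p l b ∧ cnt p l b ≤ cnt p l a + (b - a) := by
  induction b, hab using Nat.le_induction with
  | base => simp
  | succ b _ ih =>
    have := cnt_succ p l b
    push_cast
    omega

/-- The set of cells whose `n`-th diagonal occupies the rows from `cnt Prod.fst l n` to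
`cnt Prod.snd l n`, for `n ≤ l.length`. -/
noncomputable def cellsOf (l : List (Bool × Bool)) : Finset (ℤ × ℤ) :=
  (Finset.range (l.length + 1)).biUnion fun n =>
    (Finset.Icc (cnt Prod.fst l n) (cnt Prod.snd l n)).image fun i => (i, i - n)

theorem mem_cellsOf {l : List (Bool × Bool)} {c : ℤ × ℤ} :
    c ∈ cellsOf l ↔ ∃ n ≤ l.length, c.1 - c.2 = n ∧ cnt Prod.fst l n ≤ c.1 ∧
      c.1 ≤ cnt Prod.snd l n := by
  simp only [cellsOf, Finset.mem_biUnion, Finset.mem_range, Nat.lt_succ_iff, Finset.mem_image,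
    Finset.mem_Icc]
  refine exists_congr fun n => and_congr_right fun _ => ?_
  constructor
  · rintro ⟨i, h, rfl⟩
    exact ⟨by simp, h⟩
  · rintro ⟨h1, h2⟩
    exact ⟨c.1, h2, Prod.ext rfl (by simp; omega)⟩

theorem mk_mem_cellsOf {l : List (Bool × Bool)} {i : ℤ} {n : ℕ} :
    ((i, i - n) : ℤ × ℤ) ∈ cellsOf l ↔
      n ≤ l.length ∧ cnt Prod.fst l n ≤ i ∧ i ≤ cnt Prod.snd l n := by
  rw [mem_cellsOf]
  constructor
  · rintro ⟨n', h, h1, h2⟩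
    obtain rfl : n' = n := by simp at h1; omega
    exact ⟨h, h2⟩
  · rintro ⟨h, h1⟩
    exact ⟨n, h, by simp, h1⟩

theorem card_cellsOf (l : List (Bool × Bool)) : (cellsOf l).card = pathArea 0 l := by
  rw [cellsOf, Finset.card_biUnion]
  · refine Finset.sum_congr rfl fun n _ => ?_
    rw [Finset.card_image_of_injective _ (fun a b h => (Prod.ext_iff.1 h).1), Int.card_Icc, height]
    congr 1
    ring
  · intro a _ b _ hab
    rw [Function.onFun, Finset.disjoint_left]
    intro c hc hc'
    obtain ⟨i, -, rfl⟩ := Finset.mem_image.1 hc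
    obtain ⟨j, -, h⟩ := Finset.mem_image.1 hc'
    simp only [Prod.ext_iff] at h
    omega

theorem diagonalsLE_cellsOf {m : ℕ} {l : List (Bool × Bool)} (hv : Valid m 0 l) :
    DiagonalsLE (m + 1) (cellsOf l) := by
  intro k
  by_cases h : ∃ n : ℕ, n ≤ l.length ∧ k = n
  · obtain ⟨n, hn, rfl⟩ := h
    have hsub : diagonal (cellsOf l) n ⊆
        (Finset.Icc (cnt Prod.fst l n) (cnt Prod.snd l n)).image fun i => (i, i - (n : ℤ)) := by
      intro c hc
      obtain ⟨hc, hk⟩ := Finset.mem_filter.1 hc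
      have hcc : c = (c.1, c.1 - (n : ℤ)) := Prod.ext rfl (by simp; omega)
      rw [hcc, mk_mem_cellsOf] at hc
      exact Finset.mem_image.2 ⟨c.1, Finset.mem_Icc.2 hc.2, hcc.symm⟩
    refine (Finset.card_le_card hsub).trans (Finset.card_image_le.trans ?_)
    have := (hv.1 n hn).2
    rw [height] at this
    rw [Int.card_Icc]
    omega
  · have : diagonal (cellsOf l) k = ∅ := by
      refine Finset.filter_eq_empty_iff.2 fun c hc hk => h ?_
      obtain ⟨n, hn, h1, -⟩ := mem_cellsOf.1 hc
      exact ⟨n, hn, by omega⟩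
    simp [this]

theorem Valid.cnt_le {m : ℕ} {l : List (Bool × Bool)} (hv : Valid m 0 l) {n : ℕ}
    (hn : n ≤ l.length) : cnt Prod.fst l n ≤ cnt Prod.snd l n := by
  have := (hv.1 n hn).1
  rw [height] at this
  omega

theorem Valid.cnt_length_eq {m : ℕ} {l : List (Bool × Bool)} (hv : Valid m 0 l) :
    cnt Prod.fst l l.length = cnt Prod.snd l l.length := by
  have := hv.2
  rw [height] at this
  omega

theorem zero_mem_cellsOf (l : List (Bool × Bool)) : (0 : ℤ × ℤ) ∈ cellsOf l :=
  mem_cellsOf.2 ⟨0, by omega, by simp, by simp [cnt_zero], by simp [cnt_zero]⟩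

theorem bounds_of_mem_cellsOf {l : List (Bool × Bool)} {c : ℤ × ℤ} (hc : c ∈ cellsOf l) :
    0 ≤ c.1 ∧ c.1 ≤ cnt Prod.snd l l.length ∧ c.2 ≤ 0 ∧
      cnt Prod.fst l l.length - l.length ≤ c.2 := by
  obtain ⟨n, hn, h1, h2, h3⟩ := mem_cellsOf.1 hc
  have a1 := cnt_mono Prod.fst l (Nat.zero_le n)
  have a2 := cnt_mono Prod.snd l (Nat.zero_le n)
  have a3 := cnt_mono Prod.fst l hn
  have a4 := cnt_mono Prod.snd l hn
  simp only [cnt_zero, Nat.cast_zero] at a1 a2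
  omega

/-- The ends of the diagonals grow by 0 or 1 per step, which is convexity between diagonals.
Equality of the two final ends keeps a cell between two given ones from lying past the last
diagonal. -/
theorem ordConnected_cellsOf {m : ℕ} {l : List (Bool × Bool)} (hv : Valid m 0 l) :
    (cellsOf l : Set (ℤ × ℤ)).OrdConnected := by
  refine ⟨fun a ha b hb c hc => ?_⟩
  obtain ⟨⟨h1, h2⟩, ⟨h3, h4⟩⟩ := hc
  have ba := bounds_of_mem_cellsOf ha
  have bb := bounds_of_mem_cellsOf hb
  have hend := hv.cnt_length_eq
  obtain ⟨i, hi, a1, a2, a3⟩ := mem_cellsOf.1 ha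
  obtain ⟨j, hj, b1, b2, b3⟩ := mem_cellsOf.1 hb
  obtain ⟨n, hn⟩ : ∃ n : ℕ, c.1 - c.2 = n := Int.eq_ofNat_of_zero_le (by omega)
  refine mem_cellsOf.2 ⟨n, by omega, hn, ?_, ?_⟩
  · rcases le_total n i with h | h
    · have := cnt_mono Prod.fst l h
      omega
    · have := cnt_mono Prod.fst l h
      omega
  · rcases le_total n j with h | h
    · have := cnt_mono Prod.snd l h
      omega
    · have := cnt_mono Prod.snd l h
      omega

/-- The lower ends of consecutive diagonals are comparable, as is any cell with the lower end of its
diagonal, so `reachable_of_le` joins everything to the origin. -/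
theorem connected_cellsOf {m : ℕ} {l : List (Bool × Bool)} (hv : Valid m 0 l) :
    Connected (cellsOf l) := by
  have hS := ordConnected_cellsOf hv
  have hlo : ∀ n : ℕ, n ≤ l.length →
      ((cnt Prod.fst l n, cnt Prod.fst l n - n) : ℤ × ℤ) ∈ cellsOf l := fun n hn =>
    mk_mem_cellsOf.2 ⟨hn, le_rfl, hv.cnt_le hn⟩
  have h1 : ∀ n : ℕ, n ≤ l.length → Relation.ReflTransGen (AdjIn (cellsOf l)) 0
      (cnt Prod.fst l n, cnt Prod.fst l n - n) := by
    intro n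
    induction n with
    | zero =>
      intro _
      simp only [cnt_zero, Nat.cast_zero, sub_zero]
      exact .refl
    | succ n ih =>
      intro hn
      refine (ih (by omega)).trans ?_
      have hstep := cnt_succ Prod.fst l n
      rcases (show cnt Prod.fst l (n + 1) = cnt Prod.fst l n ∨
        cnt Prod.fst l (n + 1) = cnt Prod.fst l n + 1 by omega) with h | h
      · exact reachable_symm (reachable_of_le hS (hlo _ hn)
          (hlo n (by omega)) ⟨by simp [h], by simp [h]; omega⟩)
      · exact reachable_of_le hS (hlo n (by omega)) (hlo _ hn) ⟨by simp [h], by simp [h]⟩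
  have h2 : ∀ c ∈ cellsOf l, Relation.ReflTransGen (AdjIn (cellsOf l)) 0 c := by
    intro c hc
    obtain ⟨n, hn, a1, a2, a3⟩ := mem_cellsOf.1 hc
    exact (h1 n hn).trans (reachable_of_le hS (hlo n hn) hc ⟨a2, by simp; omega⟩)
  exact fun u hu v hv =>
    (reachable_symm (h2 u hu)).trans (h2 v hv)

theorem row_cellsOf {m : ℕ} {l : List (Bool × Bool)} (hv : Valid m 0 l) :
    row (cellsOf l) = l.countP Prod.snd + 1 := by
  have : (cellsOf l).image Prod.fst = Finset.Icc 0 (cnt Prod.snd l l.length) := by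
    ext i
    rw [Finset.mem_image, Finset.mem_Icc]
    constructor
    · rintro ⟨c, hc, rfl⟩
      have := bounds_of_mem_cellsOf hc
      exact ⟨this.1, this.2.1⟩
    · rintro ⟨h0, h1⟩
      classical
      -- On the first diagonal whose upper end reaches row `i`, that end is exactly `i`.
      have hex : ∃ n, i ≤ cnt Prod.snd l n := ⟨_, h1⟩
      have hn := Nat.find_spec hex
      have hle : Nat.find hex ≤ l.length := Nat.find_min' hex h1
      refine ⟨(i, i - (Nat.find hex : ℕ)), mk_mem_cellsOf.2 ⟨hle, ?_, hn⟩, rfl⟩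
      rcases hk : Nat.find hex with _ | k
      · rwa [cnt_zero]
      · have hlt := Nat.find_min hex (m := k) (by omega)
        have := cnt_succ Prod.snd l k
        have := hv.cnt_le hle
        rw [hk] at this
        omega
  rw [row, this, Int.card_Icc, cnt_length]
  omega

theorem col_cellsOf {m : ℕ} {l : List (Bool × Bool)} (hv : Valid m 0 l) :
    col (cellsOf l) = l.countP (fun e => !e.1) + 1 := by
  have : (cellsOf l).image Prod.snd = Finset.Icc (cnt Prod.fst l l.length - l.length) 0 := by
    ext j
    rw [Finset.mem_image, Finset.mem_Icc]
    constructor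
    · rintro ⟨c, hc, rfl⟩
      have := bounds_of_mem_cellsOf hc
      exact ⟨this.2.2.2, this.2.2.1⟩
    · rintro ⟨h1, h0⟩
      classical
      -- The column of the lower end drops by at most one per step, so it equals `j` on the first
      -- diagonal where it is at most `j`.
      have hex : ∃ n : ℕ, cnt Prod.fst l n - n ≤ j := ⟨_, h1⟩
      have hn := Nat.find_spec hex
      have hle : Nat.find hex ≤ l.length := Nat.find_min' hex h1
      have hmem : ((j + (Nat.find hex : ℕ), j + (Nat.find hex : ℕ) - (Nat.find hex : ℕ)) : ℤ × ℤ) ∈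
          cellsOf l := by
        refine mk_mem_cellsOf.2 ⟨hle, by omega, ?_⟩
        rcases hk : Nat.find hex with _ | k
        · rw [cnt_zero]
          simpa using h0
        · have hlt := Nat.find_min hex (m := k) (by omega)
          have := cnt_succ Prod.fst l k
          have := hv.cnt_le hle
          rw [hk] at this
          push_cast
          omega
      exact ⟨_, hmem, by simp⟩
  have hlen : l.length = l.countP Prod.fst + l.countP (fun e => !e.1) := by
    rw [List.length_eq_countP_add_countP (p := Prod.fst)]
    simp
  rw [col, this, Int.card_Icc, cnt_length]
  omega

/-! ### The cells determine the path -/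

theorem eq_of_cnt_eq {l l' : List (Bool × Bool)} (hl : l.length = l'.length)
    (h1 : ∀ n ≤ l.length, cnt Prod.fst l n = cnt Prod.fst l' n)
    (h2 : ∀ n ≤ l.length, cnt Prod.snd l n = cnt Prod.snd l' n) : l = l' := by
  induction l generalizing l' with
  | nil => exact (List.length_eq_zero_iff.1 hl.symm).symm
  | cons e l ih =>
    rcases l' with _ | ⟨e', l'⟩
    · simp at hl
    have a1 := h1 1 (by simp)
    have a2 := h2 1 (by simp)
    rw [← zero_add 1, cnt_cons_succ, cnt_cons_succ, cnt_zero, cnt_zero] at a1 a2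
    have he : e = e' := by
      rcases e with ⟨a, b⟩
      rcases e' with ⟨a', b'⟩
      cases a <;> cases a' <;> cases b <;> cases b' <;> simp_all
    subst he
    congr 1
    refine ih (by simpa using hl) (fun n hn => ?_) (fun n hn => ?_)
    · have := h1 (n + 1) (by simpa using hn)
      rw [cnt_cons_succ, cnt_cons_succ] at this
      omega
    · have := h2 (n + 1) (by simpa using hn)
      rw [cnt_cons_succ, cnt_cons_succ] at this
      omega

theorem cellsOf_injective_aux {m : ℕ} {l l' : List (Bool × Bool)} (hv : Valid m 0 l)
    (h : cellsOf l ⊆ cellsOf l') {n : ℕ} (hn : n ≤ l.length) :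
    n ≤ l'.length ∧ cnt Prod.fst l' n ≤ cnt Prod.fst l n ∧ cnt Prod.snd l n ≤ cnt Prod.snd l' n := by
  have h1 := mk_mem_cellsOf.1 (h (mk_mem_cellsOf.2 ⟨hn, le_rfl, hv.cnt_le hn⟩))
  have h2 := mk_mem_cellsOf.1 (h (mk_mem_cellsOf.2 ⟨hn, hv.cnt_le hn, le_rfl⟩))
  exact ⟨h1.1, h1.2.1, h2.2.2⟩

theorem eq_of_cellsOf_eq_translate {m : ℕ} {l l' : List (Bool × Bool)} (hv : Valid m 0 l)
    (hv' : Valid m 0 l') {v : ℤ × ℤ} (h : cellsOf l = translate v (cellsOf l')) : l = l' := by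
  have h1 : v ∈ cellsOf l := by
    rw [h, mem_translate, sub_self]
    exact zero_mem_cellsOf _
  have h2 : 0 - v ∈ cellsOf l' := by
    rw [← mem_translate, ← h]
    exact zero_mem_cellsOf _
  have b1 := bounds_of_mem_cellsOf h1
  have b2 := bounds_of_mem_cellsOf h2
  simp only [Prod.fst_sub, Prod.snd_sub, Prod.fst_zero, Prod.snd_zero] at b2
  -- Both sets contain the origin and lie in the quadrant of rows `≥ 0` and columns `≤ 0`, so `v`
  -- and `-v` both lie in it.
  have hv0 : v = 0 := Prod.ext (by simp; omega) (by simp; omega)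
  rw [hv0, translate_zero] at h
  have k1 := fun n => cellsOf_injective_aux hv h.le (n := n)
  have k2 := fun n => cellsOf_injective_aux hv' h.ge (n := n)
  have hlen : l.length = l'.length := le_antisymm (k1 _ le_rfl).1 (k2 _ le_rfl).1
  refine eq_of_cnt_eq hlen (fun n hn => ?_) (fun n hn => ?_)
  · exact le_antisymm (k2 n (hlen ▸ hn)).2.1 (k1 n hn).2.1
  · exact le_antisymm (k1 n hn).2.2 (k2 n (hlen ▸ hn)).2.2

end SkewGF

/-! ### Diagonals of order-convex sets -/

namespace Cells

/-- The diagonal `i - j = k` of `S` occupies exactly the rows from `s` to `t`, where `s ≤ t`. -/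
def DiagonalIs (S : Finset (ℤ × ℤ)) (k s t : ℤ) : Prop :=
  s ≤ t ∧ ∀ i, ((i, i - k) : ℤ × ℤ) ∈ S ↔ s ≤ i ∧ i ≤ t

theorem exists_diagonalIs {S : Finset (ℤ × ℤ)} (hS : (S : Set (ℤ × ℤ)).OrdConnected)
    {k : ℤ} (hk : ∃ w ∈ S, w.1 - w.2 = k) : ∃ s t, DiagonalIs S k s t := by
  have hne : (diagonal S k).Nonempty := by
    obtain ⟨w, hw, h⟩ := hk
    exact ⟨w, Finset.mem_filter.2 ⟨hw, h⟩⟩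
  obtain ⟨u, hu, hmin⟩ := Finset.exists_min_image _ Prod.fst hne
  obtain ⟨v, hv, hmax⟩ := Finset.exists_max_image _ Prod.fst hne
  refine ⟨u.1, v.1, hmin v hv, fun i => ⟨fun hi => ?_, fun hi => ?_⟩⟩
  · have : ((i, i - k) : ℤ × ℤ) ∈ diagonal S k := Finset.mem_filter.2 ⟨hi, by simp⟩
    exact ⟨hmin _ this, hmax _ this⟩
  · obtain ⟨hu, hu'⟩ := Finset.mem_filter.1 hu
    obtain ⟨hv, hv'⟩ := Finset.mem_filter.1 hv
    exact hS.out hu hv ⟨⟨hi.1, by simp; omega⟩, ⟨hi.2, by simp; omega⟩⟩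

section

variable {S : Finset (ℤ × ℤ)} {k s t s' t' : ℤ}

theorem DiagonalIs.left_mem (h : DiagonalIs S k s t) : ((s, s - k) : ℤ × ℤ) ∈ S :=
  (h.2 s).2 ⟨le_rfl, h.1⟩

theorem DiagonalIs.right_mem (h : DiagonalIs S k s t) : ((t, t - k) : ℤ × ℤ) ∈ S :=
  (h.2 t).2 ⟨h.1, le_rfl⟩

/-- If an inequality failed, convexity would put a cell just outside the interval of one of the two
diagonals. -/
theorem DiagonalIs.succ (hS : (S : Set (ℤ × ℤ)).OrdConnected) (h : DiagonalIs S k s t)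
    (h' : DiagonalIs S (k + 1) s' t') : (s ≤ s' ∧ s' ≤ s + 1) ∧ t ≤ t' ∧ t' ≤ t + 1 := by
  refine ⟨⟨?_, ?_⟩, ?_, ?_⟩ <;> by_contra! hlt
  · have := (h.2 s').1 (hS.out h'.left_mem h.left_mem
      ⟨⟨le_rfl, by simp; omega⟩, ⟨by simp; omega, by simp; omega⟩⟩)
    omega
  · have := (h'.2 (s + 1)).1 (hS.out h.left_mem h'.left_mem
      ⟨⟨by simp, by simp⟩, ⟨by simp; omega, by simp; omega⟩⟩)
    omega
  · have := (h'.2 t).1 (hS.out h'.right_mem h.right_mem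
      ⟨⟨by simp; omega, by simp; omega⟩, ⟨by simp, by simp; omega⟩⟩)
    omega
  · have := (h.2 (t + 1)).1 (hS.out h.right_mem h'.right_mem
      ⟨⟨by simp, by simp⟩, ⟨by simp; omega, by simp; omega⟩⟩)
    omega

theorem DiagonalIs.card (h : DiagonalIs S k s t) : t + 1 - s ≤ (diagonal S k).card := by
  have hsub : (Finset.Icc s t).image (fun i => ((i, i - k) : ℤ × ℤ)) ⊆ diagonal S k := by
    intro c hc
    obtain ⟨i, hi, rfl⟩ := Finset.mem_image.1 hc
    exact Finset.mem_filter.2 ⟨(h.2 i).2 (Finset.mem_Icc.1 hi), by simp⟩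
  have := Finset.card_le_card hsub
  rw [Finset.card_image_of_injective _ (fun a b h => (Prod.ext_iff.1 h).1), Int.card_Icc] at this
  omega

/-- Two cells on one diagonal force, by convexity, cells on both neighbouring diagonals. -/
theorem DiagonalIs.eq_of_forall_le (hS : (S : Set (ℤ × ℤ)).OrdConnected)
    (h : DiagonalIs S k s t) (hk : (∀ c ∈ S, k ≤ c.1 - c.2) ∨ ∀ c ∈ S, c.1 - c.2 ≤ k) :
    s = t := by
  by_contra hne
  have hlt : s < t := lt_of_le_of_ne h.1 hne
  rcases hk with hk | hk
  · have := hk (s, s - k + 1) (hS.out h.left_mem h.right_mem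
      ⟨⟨le_rfl, by simp⟩, ⟨h.1, by simp; omega⟩⟩)
    simp at this
    omega
  · have := hk (s + 1, s - k) (hS.out h.left_mem h.right_mem
      ⟨⟨by simp, le_rfl⟩, ⟨by simp; omega, by simp; omega⟩⟩)
    simp at this

end

end Cells

/-! ### From connected convex sets to paths -/

namespace SkewGF

open Cells

theorem exists_list_diagonalIs {S : Finset (ℤ × ℤ)} (hS : (S : Set (ℤ × ℤ)).OrdConnected)
    (n : ℕ) {k s t : ℤ} (h : DiagonalIs S k s t)
    (hne : ∀ j : ℕ, j ≤ n → ∃ w ∈ S, w.1 - w.2 = k + j) :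
    ∃ l : List (Bool × Bool), l.length = n ∧ ∀ j ≤ n,
      DiagonalIs S (k + j) (s + cnt Prod.fst l j) (t + cnt Prod.snd l j) := by
  induction n generalizing k s t with
  | zero =>
    refine ⟨[], rfl, fun j hj => ?_⟩
    obtain rfl : j = 0 := by omega
    simpa [cnt_zero] using h
  | succ n ih =>
    obtain ⟨s', t', h'⟩ := exists_diagonalIs hS (k := k + 1) (by simpa using hne 1 (by omega))
    obtain ⟨l, hl, hl'⟩ := ih h' (fun j hj => by
      simpa [add_assoc, add_comm (1 : ℤ)] using hne (j + 1) (by omega))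
    have hstep := h.succ hS h'
    refine ⟨(decide (s' = s + 1), decide (t' = t + 1)) :: l, by simp [hl], fun j hj => ?_⟩
    cases j with
    | zero => simpa [cnt_zero] using h
    | succ j =>
      rw [cnt_cons_succ, cnt_cons_succ]
      convert hl' j (by omega) using 1
      · push_cast
        ring
      · simp only [decide_eq_true_eq]
        split_ifs <;> omega
      · simp only [decide_eq_true_eq]
        split_ifs <;> omega

theorem exists_valid_eq_translate {m : ℕ} {S : Finset (ℤ × ℤ)}
    (hS : (S : Set (ℤ × ℤ)).OrdConnected) (hc : Connected S) (hne : S.Nonempty)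
    (hd : DiagonalsLE (m + 1) S) :
    ∃ (l : List (Bool × Bool)) (v : ℤ × ℤ), Valid m 0 l ∧ S = translate v (cellsOf l) := by
  obtain ⟨a, ha, hmin⟩ := Finset.exists_min_image S (fun c => c.1 - c.2) hne
  obtain ⟨b, hb, hmax⟩ := Finset.exists_max_image S (fun c => c.1 - c.2) hne
  obtain ⟨n, hn⟩ : ∃ n : ℕ, (b.1 - b.2) - (a.1 - a.2) = n :=
    Int.eq_ofNat_of_zero_le (by have := hmin b hb; omega)
  obtain ⟨s, t, hst⟩ := exists_diagonalIs hS ⟨a, ha, rfl⟩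
  obtain rfl := hst.eq_of_forall_le hS (Or.inl hmin)
  obtain ⟨l, hl, hl'⟩ := exists_list_diagonalIs hS n hst (fun j hj =>
    hc.exists_mem_diagonal ha hb (by omega) (by omega))
  subst hl
  have hend := (hl' l.length le_rfl).eq_of_forall_le hS (Or.inr fun c hc => by
    have := hmax c hc
    omega)
  refine ⟨l, (s, s - (a.1 - a.2)), ⟨fun j hj => ?_, ?_⟩, ?_⟩
  · have h1 := (hl' j hj).1
    have h2 := (hl' j hj).card
    have h3 := hd (a.1 - a.2 + j)
    rw [height]
    omega
  · rw [height]
    omega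
  · ext c
    rw [mem_translate, mem_cellsOf]
    have key : ∀ j : ℕ, c.1 - c.2 = a.1 - a.2 + j → j ≤ l.length →
        (c ∈ S ↔ s + cnt Prod.fst l j ≤ c.1 ∧ c.1 ≤ s + cnt Prod.snd l j) := by
      intro j hj hjl
      rw [← (hl' j hjl).2 c.1]
      have : c = (c.1, c.1 - (a.1 - a.2 + j)) := Prod.ext rfl (by simp; omega)
      rw [← this]
    simp only [Prod.fst_sub, Prod.snd_sub]
    constructor
    · intro hcS
      have h1 := hmin c hcS
      have h2 := hmax c hcS
      obtain ⟨j, hj⟩ : ∃ j : ℕ, (c.1 - c.2) - (a.1 - a.2) = j :=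
        Int.eq_ofNat_of_zero_le (by omega)
      have h3 := (key j (by omega) (by omega)).1 hcS
      exact ⟨j, by omega, by omega, by omega, by omega⟩
    · rintro ⟨j, hj, h1, h2, h3⟩
      exact (key j (by omega) hj).2 ⟨by omega, by omega⟩

/-! ### The bijection and its weights -/

/-- The cells described by a valid path are, up to translation, those of a skew diagram. -/
theorem exists_skewDiagram {m : ℕ} (l : {l // Valid m 0 l}) :
    ∃ (s : SkewDiagram) (v : ℤ × ℤ), s.cells = translate v (cellsOf l.1) :=
  SkewDiagram.exists_cells_eq_translate _ (ordConnected_cellsOf l.2)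

/-- The skew shape described by a valid path. -/
noncomputable def shapeOf (m : ℕ) (l : {l // Valid m 0 l}) : SkewShape.CSle (m + 1) :=
  ⟨Quotient.mk SkewDiagram.setoid (exists_skewDiagram l).choose, by
    obtain ⟨v, hv⟩ := (exists_skewDiagram l).choose_spec
    refine ⟨⟨?_, ?_⟩, ?_⟩
    · change 0 < Finset.card (SkewDiagram.cells _)
      rw [hv, card_translate]
      exact Finset.card_pos.2 ⟨0, zero_mem_cellsOf _⟩
    · change Cells.Connected (SkewDiagram.cells _)
      rw [hv]
      exact (connected_cellsOf l.2).translate v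
    · change Cells.DiagonalsLE (m + 1) (SkewDiagram.cells _)
      rw [hv]
      exact (diagonalsLE_cellsOf l.2).translate v⟩

theorem shapeOf_bijective (m : ℕ) : Function.Bijective (shapeOf m) := by
  constructor
  · intro l l' h
    obtain ⟨v, hv⟩ := (exists_skewDiagram l).choose_spec
    obtain ⟨v', hv'⟩ := (exists_skewDiagram l').choose_spec
    obtain ⟨w, hw⟩ := Quotient.exact (Subtype.ext_iff.1 h)
    rw [hv, hv', translate_translate] at hw
    refine (Subtype.ext (eq_of_cellsOf_eq_translate l'.2 l.2 (v := v + w - v') ?_)).symm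
    rw [sub_eq_add_neg, ← translate_translate, ← hw, translate_translate, add_neg_cancel,
      translate_zero]
  · rintro ⟨α, hα⟩
    induction α using Quotient.inductionOn with
    | h s =>
      obtain ⟨⟨h0, hc⟩, hd⟩ := hα
      obtain ⟨l, v, hl, hv⟩ := exists_valid_eq_translate s.ordConnected_cells hc
        (Finset.card_pos.1 h0) hd
      obtain ⟨w, hw⟩ := (exists_skewDiagram ⟨l, hl⟩).choose_spec
      refine ⟨⟨l, hl⟩, Subtype.ext (Quotient.sound ⟨-w + v, ?_⟩)⟩
      rw [← translate_translate, hw, Cells.translate_translate w, add_neg_cancel, translate_zero, hv]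

/-- The factor `x * y` accounts for the column and row of the starting cell, which no step records.
-/
theorem term_shapeOf (m : ℕ) (l : {l // Valid m 0 l}) :
    x ^ (shapeOf m l).1.col * y ^ (shapeOf m l).1.row * q ^ (shapeOf m l).1.area =
      x * y * weight m 0 l.1 := by
  obtain ⟨v, hv⟩ := (exists_skewDiagram l).choose_spec
  have h1 : (shapeOf m l).1.col = l.1.countP (fun e => !e.1) + 1 := by
    rw [← col_cellsOf l.2, ← col_translate v, ← hv]
    rfl
  have h2 : (shapeOf m l).1.row = l.1.countP Prod.snd + 1 := by
    rw [← row_cellsOf l.2, ← row_translate v, ← hv]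
    rfl
  have h3 : (shapeOf m l).1.area = pathArea 0 l.1 := by
    rw [← card_cellsOf, ← card_translate v, ← hv]
    rfl
  rw [h1, h2, h3, weight, if_pos l.2]
  ring

end SkewGF

theorem mainTheorem3 (m : ℕ) :
    HasSum (fun α : SkewShape.CSle (m + 1) =>
        SkewGF.x ^ α.1.col * SkewGF.y ^ α.1.row * SkewGF.q ^ α.1.area)
      (SkewGF.contFrac m 0) := by
  rw [← (Equiv.ofBijective _ (SkewGF.shapeOf_bijective m)).hasSum_iff, ← SkewGF.mul_pathGF_zero]
  have h := (SkewGF.hasSum_weight m 0).mul_left (SkewGF.x * SkewGF.y)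
  -- The weight vanishes off valid paths, so the sum over all lists restricts to them.
  rw [← hasSum_subtype_iff_of_support_subset (s := {l | SkewGF.Valid m 0 l})] at h
  · exact h.congr_fun (fun l => SkewGF.term_shapeOf m l)
  · intro l hl
    by_contra hv
    exact hl (by simp [SkewGF.weight, show ¬ SkewGF.Valid m 0 l from hv])
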